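/- For quantities $x,y$ and $\alpha\ge 1$ write $x\approx_\alpha y$ if $\frac1\alpha x\le y\le \alpha x$. Let $A$ be a real $n\times d$ matrix of full column rank with rows $a_1^T,\dots,a_n^T$. Its $\ell_1$ Lewis weights are the nonnegative weights $\bar w_1,\dots,\bar w_n$ such that, with $\bar W=\mathrm{diag}(\bar w)$, the matrix $A^T\bar W^{-1}A$ is invertible (zero rows, which have weight $0$, being omitted from it) and $a_i^T(A^T\bar W^{-1}A)^{-1}a_i=\bar w_i^2$ for every $i$. Given sampling values $p_1,\dots,p_n\ge 0$ whose sum $N=\sum_i p_i$ is a positive integer, let $S$ be the random $N\times n$ matrix whose rows are chosen independently, each being $\frac1{p_i}$ times the $i$-th standard basis vector with probability $\frac{p_i}{N}$. (1) For every $c>0$ there is a constant $C_s>0$, depending only on $c$, such that for every such $A$, every $0<\epsilon\le 1$ and all sampling values $p_i$ with $\sum_i p_i=N$ a positive integer and $$p_i\ \ge\ C_s\,\bar w_i\,\log(N)\,\epsilon^{-2}\qquad\text{for all } i,$$ with probability at least $1-N^{-c}$ one has $\|SAx\|_1\approx_{1+\epsilon}\|Ax\|_1$ for all $x\in\mathbb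 R^d$ simultaneously. (2) In particular, $O(d\log(d/\epsilon)\epsilon^{-2})$ row samples suffice, given constant-factor approximations to the Lewis weights: for every $c>0$ and $\alpha\ge1$ there is a constant $K>0$, depending only on $c$ and $\alpha$, such that for every such $A$, every $0<\epsilon\le1$ with $d/\epsilon\ge 2$, all weights $w'$ with $\bar w_i\approx_\alpha w'_i$ for all $i$, and every integer $N\ge K\,d\log(d/\epsilon)\,\epsilon^{-2}$, sampling $N$ rows as above with $p_i=N w'_i/\sum_j w'_j$ gives, with probability at least $1-N^{-c}$, $\|SAx\|_1\approx_{1+\epsilon}\|Ax\|_1$ for all $x\in\mathbb R^d$ simultaneously. -/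

import Mathlib

open MeasureTheory ProbabilityTheory
open scoped Matrix

noncomputable section

/-- `x ≈_α y`: the quantities `x` and `y` agree up to the factor `α`. -/
def ApproxFactor (α x y : ℝ) : Prop :=
  1 / α * x ≤ y ∧ y ≤ α * x

/-- The `ℓ₁` norm of a vector. -/
def l1norm {m : ℕ} (v : Fin m → ℝ) : ℝ :=
  ‖WithLp.toLp 1 v‖

/-- The quadratic form `Aᵀ W⁻¹ A` attached to a matrix `A` and weights `w`, with `W = diag w`.
A row of weight `0` contributes nothing (`0⁻¹ = 0`). -/
def lewisForm {n d : ℕ} (A : Matrix (Fin n) (Fin d) ℝ) (w : Fin n → ℝ) :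
    Matrix (Fin d) (Fin d) ℝ :=
  Aᵀ * Matrix.diagonal (fun i => (w i)⁻¹) * A

/-- `w` are the `ℓ₁` Lewis weights of `A`: nonnegative weights for which `Aᵀ W⁻¹ A` is invertible
and `aᵢᵀ (Aᵀ W⁻¹ A)⁻¹ aᵢ = wᵢ²` for every row `aᵢ` of `A`.

Invertibility is what the formula presupposes; it excludes the spurious solution `w = 0`, it forces
`A` to have full column rank, and together with the equation it makes `w i = 0` happen exactly at
the zero rows of `A`. -/
structure IsL1LewisWeights {n d : ℕ} (A : Matrix (Fin n) (Fin d) ℝ) (w : Fin n → ℝ) : Prop where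
  nonneg : ∀ i, 0 ≤ w i
  isUnit_det : IsUnit (lewisForm A w).det
  row_eq : ∀ i, A i ⬝ᵥ ((lewisForm A w)⁻¹ *ᵥ A i) = w i ^ 2

/-- `idx 0, …, idx (N - 1)` are independent random row indices, each equal to `i` with probability
`p i / N`. -/
structure IsRowSampling {Ω : Type*} [MeasurableSpace Ω] {n N : ℕ} (μ : Measure Ω)
    (p : Fin n → ℝ) (idx : Fin N → Ω → Fin n) : Prop where
  measurable : ∀ k, Measurable (idx k)
  indep : iIndepFun idx μ
  law : ∀ k i, μ {ω | idx k ω = i} = ENNReal.ofReal (p i / N)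

/-- The matrix `S` whose `k`-th row is `1 / p i` times the `i`-th standard basis vector, where
`i = r k` is the `k`-th chosen row index. -/
def samplingMatrix {n N : ℕ} (p : Fin n → ℝ) (r : Fin N → Fin n) : Matrix (Fin N) (Fin n) ℝ :=
  Matrix.of fun k => Pi.single (r k) (1 / p (r k))

/-- `‖S A x‖₁ ≈_{1+ε} ‖A x‖₁` for all vectors `x`. -/
def PreservesL1 {n d N : ℕ} (ε : ℝ) (S : Matrix (Fin N) (Fin n) ℝ)
    (A : Matrix (Fin n) (Fin d) ℝ) : Prop :=
  ∀ x : Fin d → ℝ, ApproxFactor (1 + ε) (l1norm ((S * A) *ᵥ x)) (l1norm (A *ᵥ x))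

end

/-
Choose one bad test vector for each bad outcome of the sampling and put these vectors into one
matrix `X`: the error over all of them is the sup norm of a sum of independent random vectors made
from the rows of `C = A X`. Its `2q`-th moment, `q` of order `log N`, is bounded by symmetrization
and by the contraction principle, which removes the absolute values and leaves a Rademacher sum of
the sampled rows. For such a sum, Lewis weights give a reproducing formula: each row is a
combination of all rows whose coefficients have variance controlled by the weights, so Khintchine's
inequality for the coefficients and a weighted power mean inequality bound the sup norm by the
column `ℓ₁` norms, with no loss in the number of test vectors. The rescaled sampled rows are
appended to `C` first: this keeps the overestimate property, makes the sampled weights of order at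
most `ε² / log N`, and yields a self-bounding inequality for the moment.
-/

open scoped BigOperators

section Rademacher

variable {τ : Type*} [Fintype τ] [DecidableEq τ]

lemma pow_two_mul_div_factorial_le_cosh (q : ℕ) (x : ℝ) :
    x ^ (2 * q) / (2 * q).factorial ≤ Real.cosh x :=
  le_hasSum (Real.hasSum_cosh x) q fun j _ => by rw [pow_mul]; positivity

lemma expect_exp_sum_sign_smul (c : τ → ℝ) :
    𝔼 σ : τ → ℤˣ, Real.exp (∑ k, σ k • c k) = ∏ k, Real.cosh (c k) := by
  have hcosh (x : ℝ) : Real.cosh x = (∑ s : ℤˣ, Real.exp (s • x)) / 2 := by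
    simp [Real.cosh_eq, UnitsInt.univ]
  simp_rw [hcosh, Real.exp_sum, Finset.prod_div_distrib, Fintype.prod_sum,
    Fintype.expect_eq_sum_div_card]
  simp

lemma expect_cosh_sum_sign_smul (c : τ → ℝ) :
    𝔼 σ : τ → ℤˣ, Real.cosh (∑ k, σ k • c k) = ∏ k, Real.cosh (c k) := by
  have hneg : 𝔼 σ : τ → ℤˣ, Real.exp (-∑ k, σ k • c k) = ∏ k, Real.cosh (c k) := by
    simpa [Finset.sum_neg_distrib] using expect_exp_sum_sign_smul fun k => -c k
  simp_rw [Real.cosh_eq, ← Finset.expect_div, Finset.expect_add_distrib,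
    expect_exp_sum_sign_smul, hneg]
  simp [Real.cosh_eq]

lemma expect_cosh_mul_sum_sign_smul_le (t : ℝ) (c : τ → ℝ) :
    𝔼 σ : τ → ℤˣ, Real.cosh (t * ∑ k, σ k • c k) ≤ Real.exp (t ^ 2 * (∑ k, c k ^ 2) / 2) := by
  calc 𝔼 σ : τ → ℤˣ, Real.cosh (t * ∑ k, σ k • c k) = ∏ k, Real.cosh (t * c k) := by
        simp_rw [Finset.mul_sum, mul_smul_comm]
        exact expect_cosh_sum_sign_smul fun k => t * c k
    _ ≤ ∏ k, Real.exp ((t * c k) ^ 2 / 2) :=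
        Finset.prod_le_prod (fun k _ => (Real.cosh_pos _).le)
          fun k _ => Real.cosh_le_exp_half_sq _
    _ = Real.exp (t ^ 2 * (∑ k, c k ^ 2) / 2) := by
        simp_rw [← Real.exp_sum, ← Finset.sum_div, mul_pow, ← Finset.mul_sum]

lemma pow_two_mul_le_mul_cosh {q : ℕ} (hq : q ≠ 0) {t v : ℝ} (hv : 0 < v)
    (ht : t ^ 2 = 2 * q / v) (x : ℝ) :
    x ^ (2 * q) ≤ (2 * q) ^ q * v ^ q * Real.cosh (t * x) := by
  have hfact : ((2 * q).factorial : ℝ) ≤ (2 * q) ^ (2 * q) := by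
    exact_mod_cast Nat.factorial_le_pow (2 * q)
  have hcosh := pow_two_mul_div_factorial_le_cosh q (t * x)
  rw [div_le_iff₀ (by positivity), mul_pow, pow_mul t, ht, div_pow, div_mul_eq_mul_div,
    div_le_iff₀ (by positivity)] at hcosh
  have h2q : (0 : ℝ) < (2 * q) ^ q := by positivity
  refine le_of_mul_le_mul_left (hcosh.trans ?_) h2q
  calc Real.cosh (t * x) * (2 * q).factorial * v ^ q
      ≤ Real.cosh (t * x) * (2 * q) ^ (2 * q) * v ^ q := by gcongr
    _ = (2 * q) ^ q * ((2 * q) ^ q * v ^ q * Real.cosh (t * x)) := by ring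

/- Compare `x ^ (2 * q) / (2 * q)!` with `cosh x`, whose average over the signs is explicit, at the
scale `t ^ 2 = 2 * q / ∑ k, c k ^ 2` which balances the two. -/
theorem expect_sum_sign_smul_pow_le (q : ℕ) (c : τ → ℝ) :
    𝔼 σ : τ → ℤˣ, (∑ k, σ k • c k) ^ (2 * q) ≤ (2 * q * Real.exp 1 * ∑ k, c k ^ 2) ^ q := by
  set v := ∑ k, c k ^ 2 with hv
  rcases eq_or_ne q 0 with rfl | hq
  · simp
  have hv0 : 0 ≤ v := by positivity
  rcases hv0.eq_or_lt with hv_zero | hv_pos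
  · have hc (k : τ) : c k = 0 := by
      simpa using (Finset.sum_eq_zero_iff_of_nonneg fun k _ => sq_nonneg (c k)).1
        (hv.symm.trans hv_zero.symm) k (Finset.mem_univ k)
    simp [hc, ← hv_zero, hq]
  set t := √(2 * q / v)
  have ht : t ^ 2 = 2 * q / v := Real.sq_sqrt (by positivity)
  have hmgf : 𝔼 σ : τ → ℤˣ, Real.cosh (t * ∑ k, σ k • c k) ≤ Real.exp 1 ^ q := by
    refine (expect_cosh_mul_sum_sign_smul_le t c).trans_eq ?_
    rw [ht, ← hv, ← Real.exp_nat_mul]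
    congr 1
    field_simp
  calc 𝔼 σ : τ → ℤˣ, (∑ k, σ k • c k) ^ (2 * q)
      ≤ 𝔼 σ : τ → ℤˣ, (2 * q) ^ q * v ^ q * Real.cosh (t * ∑ k, σ k • c k) :=
        Finset.expect_le_expect fun σ _ => pow_two_mul_le_mul_cosh hq hv_pos ht _
    _ ≤ (2 * q) ^ q * v ^ q * Real.exp 1 ^ q := by
        rw [← Finset.mul_expect]
        gcongr
    _ = (2 * q * Real.exp 1 * v) ^ q := by ring

lemma expect_neg_sign (F : (τ → ℤˣ) → ℝ) : 𝔼 σ, F (-σ) = 𝔼 σ, F σ :=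
  Fintype.expect_equiv (Equiv.neg _) _ _ fun _ => rfl

lemma expect_le_expect_of_add_comp_le {β : Type*} [Fintype β] (e : β ≃ β) {F G : β → ℝ}
    (h : ∀ b, F b + F (e b) ≤ G b + G (e b)) : 𝔼 b, F b ≤ 𝔼 b, G b := by
  have hadd (H : β → ℝ) : 𝔼 b, (H b + H (e b)) = 2 * 𝔼 b, H b := by
    rw [Finset.expect_add_distrib, Fintype.expect_equiv e (fun b => H (e b)) H fun _ => rfl,
      two_mul]
  have := Finset.expect_le_expect (s := Finset.univ) fun b _ => h b
  rw [hadd, hadd] at this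
  linarith

lemma sum_sign_smul_update (σ : τ → ℤˣ) {E : Type*} [AddCommGroup E] (t : τ → E) (k : τ) (s : E) :
    ∑ j, σ j • Function.update t k s j = ∑ j ∈ {k}ᶜ, σ j • t j + σ k • s := by
  rw [Fintype.sum_eq_add_sum_compl k, add_comm, Function.update_self]
  congr 1
  refine Finset.sum_congr rfl fun j hj => ?_
  rw [Function.update_of_ne (by simpa using hj)]

end Rademacher

section Contraction

variable {τ ι : Type*} [Fintype τ] [DecidableEq τ] [Fintype ι]

lemma pi_norm_mono {a b : ι → ℝ} (ha : 0 ≤ a) (hab : a ≤ b) : ‖a‖ ≤ ‖b‖ :=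
  (pi_norm_le_iff_of_nonneg (norm_nonneg b)).2 fun i => by
    rw [Real.norm_of_nonneg (ha i)]
    exact (hab i).trans ((le_abs_self _).trans (norm_le_pi_norm b i))

lemma norm_posPart_sup_le (a b : ι → ℝ) : ‖(a ⊔ b)⁺‖ ≤ max ‖a⁺‖ ‖b⁺‖ := by
  refine (pi_norm_le_iff_of_nonneg (by positivity)).2 fun i => ?_
  rcases le_total (a i) (b i) with h | h
  · exact le_max_of_le_right (by simpa [posPart, h] using norm_le_pi_norm b⁺ i)
  · exact le_max_of_le_left (by simpa [posPart, h] using norm_le_pi_norm a⁺ i)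

lemma norm_posPart_sup_pow_add_le (a b : ι → ℝ) (p : ℕ) :
    ‖(a ⊔ b)⁺‖ ^ p + ‖(a ⊓ b)⁺‖ ^ p ≤ ‖a⁺‖ ^ p + ‖b⁺‖ ^ p := by
  have hsup := norm_posPart_sup_le a b
  have ha : ‖(a ⊓ b)⁺‖ ≤ ‖a⁺‖ := pi_norm_mono (posPart_nonneg _) (posPart_mono inf_le_left)
  have hb : ‖(a ⊓ b)⁺‖ ≤ ‖b⁺‖ := pi_norm_mono (posPart_nonneg _) (posPart_mono inf_le_right)
  rcases le_total ‖a⁺‖ ‖b⁺‖ with h | h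
  · rw [max_eq_right h] at hsup
    rw [add_comm]
    gcongr
  · rw [max_eq_left h] at hsup
    gcongr

lemma norm_posPart_add_abs_pow_add_le (f t : ι → ℝ) (p : ℕ) :
    ‖(f + |t|)⁺‖ ^ p + ‖(f - |t|)⁺‖ ^ p ≤ ‖(f + t)⁺‖ ^ p + ‖(f - t)⁺‖ ^ p := by
  have hsup : f + |t| = (f + t) ⊔ (f - t) := by
    rw [sub_eq_add_neg, ← add_sup]; rfl
  have hinf : f - |t| = (f + t) ⊓ (f - t) := by
    rw [sub_eq_add_neg f t, ← add_inf, sub_eq_add_neg, ← neg_neg t, ← neg_sup]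
    simp [abs, sup_comm]
  rw [hsup, hinf]
  exact norm_posPart_sup_pow_add_le _ _ p

lemma expect_norm_posPart_update_abs_le (t : τ → ι → ℝ) (k : τ) (p : ℕ) :
    𝔼 σ : τ → ℤˣ, ‖(∑ j, σ j • Function.update t k |t k| j)⁺‖ ^ p ≤
      𝔼 σ : τ → ℤˣ, ‖(∑ j, σ j • t j)⁺‖ ^ p := by
  refine expect_le_expect_of_add_comp_le (Equiv.mulRight (Pi.mulSingle k (-1) : τ → ℤˣ)) fun σ => ?_
  obtain ⟨f, hf⟩ : ∃ f, f = ∑ j ∈ {k}ᶜ, σ j • t j := ⟨_, rfl⟩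
  have hkeep (s : ι → ℝ) : ∑ j, σ j • Function.update t k s j = f + σ k • s := by
    rw [sum_sign_smul_update, hf]
  have hflip (s : ι → ℝ) :
      ∑ j, (σ * (Pi.mulSingle k (-1) : τ → ℤˣ)) j • Function.update t k s j = f - σ k • s := by
    rw [sum_sign_smul_update, hf, sub_eq_add_neg]
    congr 1
    · exact Finset.sum_congr rfl fun j hj => by
        simp [Pi.mulSingle_eq_of_ne (show j ≠ k by simpa using hj)]
    · simp
  have hkeep_self := hkeep (t k)
  have hflip_self := hflip (t k)
  rw [Function.update_eq_self] at hkeep_self hflip_self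
  simp only [Equiv.coe_mulRight, hkeep, hflip, hkeep_self, hflip_self]
  rcases Int.units_eq_one_or (σ k) with h | h
  · simpa [h] using norm_posPart_add_abs_pow_add_le f (t k) p
  · simpa [h, ← sub_eq_add_neg, add_comm] using norm_posPart_add_abs_pow_add_le f (t k) p

lemma expect_norm_posPart_sum_sign_smul_abs_le (t : τ → ι → ℝ) (p : ℕ) :
    𝔼 σ : τ → ℤˣ, ‖(∑ k, σ k • |t k|)⁺‖ ^ p ≤ 𝔼 σ : τ → ℤˣ, ‖(∑ k, σ k • t k)⁺‖ ^ p := by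
  suffices h : ∀ s : Finset τ,
      𝔼 σ : τ → ℤˣ, ‖(∑ k, σ k • s.piecewise (fun k => |t k|) t k)⁺‖ ^ p ≤
        𝔼 σ : τ → ℤˣ, ‖(∑ k, σ k • t k)⁺‖ ^ p by
    simpa using h Finset.univ
  intro s
  induction s using Finset.induction_on with
  | empty => simp
  | insert k s hk ih =>
    rw [Finset.piecewise_insert]
    have := expect_norm_posPart_update_abs_le (s.piecewise (fun k => |t k|) t) k p
    rw [Finset.piecewise_eq_of_notMem _ _ _ hk] at this
    exact this.trans ih

lemma norm_pow_le_posPart_add (u : ι → ℝ) (p : ℕ) : ‖u‖ ^ p ≤ ‖u⁺‖ ^ p + ‖(-u)⁺‖ ^ p := by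
  have hmax : ‖u‖ ≤ max ‖u⁺‖ ‖(-u)⁺‖ :=
    (pi_norm_le_iff_of_nonneg (by positivity)).2 fun i => by
      rcases le_total 0 (u i) with h | h
      · exact le_max_of_le_left (by simpa [posPart, h] using norm_le_pi_norm u⁺ i)
      · exact le_max_of_le_right (by simpa [posPart, h] using norm_le_pi_norm (-u)⁺ i)
  rcases le_max_iff.1 hmax with h | h
  · exact (pow_le_pow_left₀ (norm_nonneg _) h p).trans (le_add_of_nonneg_right (by positivity))
  · exact (pow_le_pow_left₀ (norm_nonneg _) h p).trans (le_add_of_nonneg_left (by positivity))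

lemma norm_posPart_le (u : ι → ℝ) : ‖u⁺‖ ≤ ‖u‖ :=
  (pi_norm_le_iff_of_nonneg (norm_nonneg u)).2 fun i => by
    refine le_trans ?_ (norm_le_pi_norm u i)
    rw [Real.norm_of_nonneg (posPart_nonneg u i)]
    exact max_le (le_abs_self (u i)) (abs_nonneg (u i))

theorem expect_norm_sum_sign_smul_abs_pow_le (t : τ → ι → ℝ) (p : ℕ) :
    𝔼 σ : τ → ℤˣ, ‖∑ k, σ k • |t k|‖ ^ p ≤ 2 * 𝔼 σ : τ → ℤˣ, ‖∑ k, σ k • t k‖ ^ p := by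
  have hneg (σ : τ → ℤˣ) : -∑ k, σ k • |t k| = ∑ k, (-σ) k • |t k| := by
    simp [Finset.sum_neg_distrib]
  calc 𝔼 σ : τ → ℤˣ, ‖∑ k, σ k • |t k|‖ ^ p
      ≤ 𝔼 σ : τ → ℤˣ, (‖(∑ k, σ k • |t k|)⁺‖ ^ p + ‖(∑ k, (-σ) k • |t k|)⁺‖ ^ p) :=
        Finset.expect_le_expect fun σ _ => by
          rw [← hneg]
          exact norm_pow_le_posPart_add _ p
    _ = 2 * 𝔼 σ : τ → ℤˣ, ‖(∑ k, σ k • |t k|)⁺‖ ^ p := by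
        rw [Finset.expect_add_distrib,
          expect_neg_sign fun σ => ‖(∑ k, σ k • |t k|)⁺‖ ^ p, two_mul]
    _ ≤ 2 * 𝔼 σ : τ → ℤˣ, ‖(∑ k, σ k • t k)⁺‖ ^ p := by
        have := expect_norm_posPart_sum_sign_smul_abs_le t p
        linarith
    _ ≤ 2 * 𝔼 σ : τ → ℤˣ, ‖∑ k, σ k • t k‖ ^ p := by
        gcongr with σ
        exact norm_posPart_le _

end Contraction

section IidMean

variable {τ κ κ' : Type*} [Fintype τ] [DecidableEq τ] [Fintype κ] [Fintype κ']

section Module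

variable {E : Type*} [AddCommGroup E] [Module ℝ E]

/-- The expectation of `F (r 1, …, r N)` for independent draws `r k` which all have the law `P`,
as a linear functional of `F`; the draws are indexed by `τ`. -/
noncomputable def iidMean (P : κ → ℝ) : ((τ → κ) → E) →ₗ[ℝ] E :=
  ∑ r, (∏ k, P (r k)) • LinearMap.proj r

lemma iidMean_apply (P : κ → ℝ) (F : (τ → κ) → E) :
    iidMean P F = ∑ r, (∏ k, P (r k)) • F r := by
  simp [iidMean]

lemma sum_prod_law_eq_one {P : κ → ℝ} (hP : ∑ j, P j = 1) : ∑ r : τ → κ, ∏ k, P (r k) = 1 := by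
  simp [← Fintype.prod_sum fun _ : τ => P, hP]

lemma iidMean_const {P : κ → ℝ} (hP : ∑ j, P j = 1) (e : E) :
    iidMean P (fun _ : τ → κ => e) = e := by
  rw [iidMean_apply, ← Finset.sum_smul, sum_prod_law_eq_one hP, one_smul]

lemma iidMean_comp_eval {P : κ → ℝ} (hP : ∑ j, P j = 1) (X : κ → E) (k : τ) :
    iidMean P (fun r : τ → κ => X (r k)) = ∑ j, P j • X j := by
  rw [iidMean_apply, ← (Equiv.funSplitAt k κ).symm.sum_comp, Fintype.sum_prod_type]
  refine Finset.sum_congr rfl fun j _ => ?_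
  simp_rw [Fintype.prod_eq_mul_prod_subtype_ne (fun _ => P _) k]
  have hne (i : {i // i ≠ k}) : (i : τ) ≠ k := i.2
  simp [Equiv.funSplitAt_symm_apply, hne, ← Finset.sum_smul, ← Finset.mul_sum,
    sum_prod_law_eq_one hP]

lemma iidMean_sum {P : κ → ℝ} (hP : ∑ j, P j = 1) (X : κ → E) :
    iidMean P (fun r : τ → κ => ∑ k, X (r k)) = Fintype.card τ • ∑ j, P j • X j := by
  have hsum : (fun r : τ → κ => ∑ k, X (r k)) = ∑ k, fun r => X (r k) := by
    ext r
    simp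
  simp [hsum, iidMean_comp_eval hP]

lemma iidMean_iidMean (P : κ → ℝ) (P' : κ' → ℝ) (F : (τ → κ) → (τ → κ') → E) :
    iidMean P (fun r => iidMean P' (F r)) =
      iidMean (fun j : κ × κ' => P j.1 * P' j.2)
        (fun s => F (fun k => (s k).1) (fun k => (s k).2)) := by
  simp_rw [iidMean_apply, Finset.smul_sum, smul_smul, ← Fintype.sum_prod_type',
    ← Finset.prod_mul_distrib]
  exact ((Equiv.arrowProdEquivProdArrow τ (fun _ => κ) fun _ => κ').sum_comp fun s =>
    (∏ k, P (s.1 k) * P' (s.2 k)) • F s.1 s.2).symm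

lemma iidMean_comp_perm {P : κ → ℝ} (e : τ → Equiv.Perm κ) (he : ∀ k j, P (e k j) = P j)
    (F : (τ → κ) → E) : iidMean P (fun r => F fun k => e k (r k)) = iidMean P F := by
  simp_rw [iidMean_apply]
  refine Fintype.sum_equiv (Equiv.piCongrRight e) _ _ fun r => ?_
  simp only [Equiv.piCongrRight_apply, Pi.map_apply, he]
  rfl

lemma iidMean_expect {β : Type*} [Fintype β] (P : κ → ℝ) (F : β → (τ → κ) → ℝ) :
    iidMean P (fun r => 𝔼 b, F b r) = 𝔼 b, iidMean P (F b) := by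
  simp_rw [iidMean_apply, Finset.smul_expect, Finset.expect_sum_comm]

lemma iidMean_iidMean_mul_add {P : κ → ℝ} (hP : ∑ j, P j = 1) (b : ℝ) (F : (τ → κ) → ℝ) :
    iidMean P (fun r => iidMean P fun r' => b * (F r + F r')) = b * (2 * iidMean P F) := by
  have hinner (r : τ → κ) : (fun r' => b * (F r + F r')) = b • ((fun _ => F r) + F) := rfl
  have houter : (fun r => F r + iidMean P F) = F + fun _ => iidMean P F := rfl
  have hsmul (G : (τ → κ) → ℝ) : (fun r => b * G r) = b • G := rfl
  simp_rw [hinner, map_smul, map_add, iidMean_const hP, smul_eq_mul, hsmul, houter, map_smul,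
    map_add, iidMean_const hP, two_mul, smul_eq_mul]

end Module

lemma iidMean_mono {P : κ → ℝ} (hP : ∀ j, 0 ≤ P j) {F G : (τ → κ) → ℝ} (h : ∀ r, F r ≤ G r) :
    iidMean P F ≤ iidMean P G := by
  simp_rw [iidMean_apply, smul_eq_mul]
  gcongr with r
  · exact Finset.prod_nonneg fun k _ => hP _
  · exact h r

lemma iidMean_norm_sum_pow_eq_sign_smul {E : Type*} [SeminormedAddCommGroup E] {P : κ → ℝ}
    {X : κ → E} (e : Equiv.Perm κ) (hP : ∀ j, P (e j) = P j)
    (hX : ∀ j, X (e j) = -X j) (σ : τ → ℤˣ) (p : ℕ) :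
    iidMean P (fun r : τ → κ => ‖∑ k, σ k • X (r k)‖ ^ p) =
      iidMean P (fun r : τ → κ => ‖∑ k, X (r k)‖ ^ p) := by
  rw [← iidMean_comp_perm (fun k => if σ k = 1 then 1 else e)
    (fun k j => by split_ifs <;> simp [hP]) fun r => ‖∑ k, X (r k)‖ ^ p]
  congr! 5 with r k
  rcases Int.units_eq_one_or (σ k) with h | h <;> simp [h, hX]

lemma add_pow_le_two_pow_mul {a b : ℝ} (ha : 0 ≤ a) (hb : 0 ≤ b) (p : ℕ) :
    (a + b) ^ p ≤ 2 ^ p * ((a ^ p + b ^ p) / 2) := by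
  cases p with
  | zero => simp
  | succ p =>
    have := add_pow_le ha hb (p + 1)
    rw [Nat.add_sub_cancel] at this
    exact this.trans_eq (by ring)

/- Exchanging the two copies in the `k`-th draw changes the sign of the `k`-th difference. -/
lemma iidMean_iidMean_norm_sum_sub_pow_le {E : Type*} [SeminormedAddCommGroup E] {P : κ → ℝ}
    (hP : ∀ j, 0 ≤ P j) (hP1 : ∑ j, P j = 1) (X : κ → E) (σ : τ → ℤˣ) (p : ℕ) :
    iidMean P (fun r => iidMean P fun r' : τ → κ => ‖∑ k, (X (r k) - X (r' k))‖ ^ p) ≤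
      2 ^ p * iidMean P (fun r : τ → κ => ‖∑ k, σ k • X (r k)‖ ^ p) := by
  have hsplit (r r' : τ → κ) : ‖∑ k, σ k • (X (r k) - X (r' k))‖ ^ p ≤
      2 ^ p / 2 * (‖∑ k, σ k • X (r k)‖ ^ p + ‖∑ k, σ k • X (r' k)‖ ^ p) := by
    simp_rw [smul_sub, Finset.sum_sub_distrib]
    refine (pow_le_pow_left₀ (norm_nonneg _) (norm_sub_le _ _) p).trans ?_
    exact (add_pow_le_two_pow_mul (norm_nonneg _) (norm_nonneg _) p).trans_eq (by ring)
  calc iidMean P (fun r => iidMean P fun r' : τ → κ => ‖∑ k, (X (r k) - X (r' k))‖ ^ p)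
      = iidMean P (fun r => iidMean P fun r' => ‖∑ k, σ k • (X (r k) - X (r' k))‖ ^ p) := by
        rw [iidMean_iidMean P P fun r r' : τ → κ => ‖∑ k, (X (r k) - X (r' k))‖ ^ p,
          iidMean_iidMean P P fun r r' => ‖∑ k, σ k • (X (r k) - X (r' k))‖ ^ p]
        exact (iidMean_norm_sum_pow_eq_sign_smul (X := fun j : κ × κ => X j.1 - X j.2)
          (Equiv.prodComm κ κ) (by simp [mul_comm]) (by simp) σ p).symm
    _ ≤ iidMean P (fun r => iidMean P fun r' =>
          2 ^ p / 2 * (‖∑ k, σ k • X (r k)‖ ^ p + ‖∑ k, σ k • X (r' k)‖ ^ p)) :=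
        iidMean_mono hP fun r => iidMean_mono hP (hsplit r)
    _ = 2 ^ p * iidMean P (fun r : τ → κ => ‖∑ k, σ k • X (r k)‖ ^ p) := by
        rw [iidMean_iidMean_mul_add hP1 _ fun r : τ → κ => ‖∑ k, σ k • X (r k)‖ ^ p]
        ring

section Normed

variable {E : Type*} [NormedAddCommGroup E] [NormedSpace ℝ E]

lemma norm_iidMean_pow_le {P : κ → ℝ} (hP : ∀ j, 0 ≤ P j) (hP1 : ∑ j, P j = 1)
    (F : (τ → κ) → E) (p : ℕ) : ‖iidMean P F‖ ^ p ≤ iidMean P (fun r => ‖F r‖ ^ p) := by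
  have hprod (r : τ → κ) : 0 ≤ ∏ k, P (r k) := Finset.prod_nonneg fun k _ => hP _
  calc ‖iidMean P F‖ ^ p ≤ (∑ r, (∏ k, P (r k)) * ‖F r‖) ^ p := by
        rw [iidMean_apply]
        gcongr
        refine norm_sum_le_of_le _ fun r _ => ?_
        rw [norm_smul, Real.norm_of_nonneg (hprod r)]
    _ ≤ iidMean P (fun r => ‖F r‖ ^ p) := by
        rw [iidMean_apply]
        exact Real.pow_arith_mean_le_arith_mean_pow _ _ _ (fun r _ => hprod r)
          (sum_prod_law_eq_one hP1) (fun r _ => norm_nonneg _) p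

lemma norm_sub_iidMean_pow_le {P : κ → ℝ} (hP : ∀ j, 0 ≤ P j) (hP1 : ∑ j, P j = 1) (e : E)
    (F : (τ → κ) → E) (p : ℕ) : ‖e - iidMean P F‖ ^ p ≤ iidMean P (fun r => ‖e - F r‖ ^ p) := by
  have hmean : iidMean P (fun r => e - F r) = e - iidMean P F := by
    rw [← iidMean_const hP1 (τ := τ) e, ← map_sub, iidMean_const hP1]
    rfl
  rw [← hmean]
  exact norm_iidMean_pow_le hP hP1 _ p

theorem iidMean_norm_sum_sub_mean_pow_le {P : κ → ℝ} (hP : ∀ j, 0 ≤ P j) (hP1 : ∑ j, P j = 1)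
    (X : κ → E) (p : ℕ) :
    iidMean P (fun r : τ → κ =>
        ‖∑ k, X (r k) - iidMean P (fun r' : τ → κ => ∑ k, X (r' k))‖ ^ p) ≤
      2 ^ p * iidMean P (fun r : τ → κ => 𝔼 σ : τ → ℤˣ, ‖∑ k, σ k • X (r k)‖ ^ p) := by
  calc iidMean P (fun r : τ → κ =>
        ‖∑ k, X (r k) - iidMean P (fun r' : τ → κ => ∑ k, X (r' k))‖ ^ p)
      ≤ iidMean P (fun r => iidMean P fun r' : τ → κ => ‖∑ k, (X (r k) - X (r' k))‖ ^ p) :=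
        iidMean_mono hP fun r => by
          simp_rw [Finset.sum_sub_distrib]
          exact norm_sub_iidMean_pow_le hP hP1 _ _ p
    _ = 𝔼 _σ : τ → ℤˣ,
          iidMean P (fun r => iidMean P fun r' : τ → κ => ‖∑ k, (X (r k) - X (r' k))‖ ^ p) :=
        (Fintype.expect_const _).symm
    _ ≤ 𝔼 σ : τ → ℤˣ, 2 ^ p * iidMean P (fun r : τ → κ => ‖∑ k, σ k • X (r k)‖ ^ p) :=
        Finset.expect_le_expect fun σ _ => iidMean_iidMean_norm_sum_sub_pow_le hP hP1 X σ p
    _ = 2 ^ p * iidMean P (fun r : τ → κ => 𝔼 σ : τ → ℤˣ, ‖∑ k, σ k • X (r k)‖ ^ p) := by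
        rw [← Finset.mul_expect, iidMean_expect]

end Normed

end IidMean

section PowerMean

variable {J ι : Type*} [Fintype J] [Fintype ι]

lemma abs_sum_mul_pow_le {u a : J → ℝ} (ha : ∀ j, |a j| ≤ u j * ∑ i, |a i|) (c : J → ℝ) {l : ℕ}
    (hl : l ≠ 0) : |∑ j, c j * a j| ^ l ≤ (∑ j, |a j|) ^ l * ∑ j, u j * |c j| ^ l := by
  set s := ∑ j, |a j|
  have hs : 0 ≤ s := by positivity
  have habs : |∑ j, c j * a j| ≤ ∑ j, |a j| * |c j| :=
    (Finset.abs_sum_le_sum_abs _ _).trans_eq (by simp_rw [abs_mul, mul_comm])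
  rcases hs.eq_or_lt with hs0 | hs0
  · have ha0 (j : J) : a j = 0 := by simpa [← hs0] using ha j
    simp [ha0, ← hs0, hl]
  calc |∑ j, c j * a j| ^ l ≤ (s * ∑ j, |a j| / s * |c j|) ^ l := by
        rw [Finset.mul_sum]
        gcongr
        refine habs.trans_eq (Finset.sum_congr rfl fun j _ => ?_)
        field_simp
    _ ≤ s ^ l * ∑ j, |a j| / s * |c j| ^ l := by
        rw [mul_pow]
        gcongr
        refine Real.pow_arith_mean_le_arith_mean_pow _ _ _ (fun j _ => by positivity) ?_
          (fun j _ => abs_nonneg _) l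
        rw [← Finset.sum_div, div_self hs0.ne']
    _ ≤ s ^ l * ∑ j, u j * |c j| ^ l := by
        gcongr with j
        exact (div_le_iff₀ hs0).2 (ha j)

lemma pi_norm_pow_le {v : ι → ℝ} {b : ℝ} {l : ℕ} (hb : 0 ≤ b) (hl : l ≠ 0)
    (h : ∀ i, |v i| ^ l ≤ b) : ‖v‖ ^ l ≤ b := by
  have hroot : (b ^ (l⁻¹ : ℝ)) ^ l = b := Real.rpow_inv_natCast_pow hb hl
  rw [← hroot]
  gcongr
  refine (pi_norm_le_iff_of_nonneg (by positivity)).2 fun i => ?_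
  exact le_of_pow_le_pow_left₀ hl (by positivity) ((h i).trans_eq hroot.symm)

end PowerMean

section LewisOverestimate

variable {J m : Type*} [Fintype J] [Fintype m]

/-- The weights `u` dominate the `ℓ₁` Lewis weights of `B` in the sense of leverage scores: each
coordinate of `B x` is at most `u j` times the norm of `B x` in the quadratic form `Bᵀ U⁻¹ B`, where
`U = diag u`. This is what the moment bounds use of Lewis weights. Unlike the defining equation of
Lewis weights it survives column operations and appending rescaled copies of rows. The convention
`0⁻¹ = 0` is harmless, because a row of weight `0` vanishes. -/
structure IsLewisOverestimate (B : Matrix J m ℝ) (u : J → ℝ) : Prop where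
  nonneg : ∀ j, 0 ≤ u j
  sq_le : ∀ j x, (B *ᵥ x) j ^ 2 ≤ u j ^ 2 * ∑ i, (u i)⁻¹ * (B *ᵥ x) i ^ 2

lemma exists_orthogonal_projection_matrix (M : Matrix J m ℝ) :
    ∃ P : Matrix J J ℝ, Pᵀ * P = P ∧ P * M = M ∧ ∀ v, ∃ x, P *ᵥ v = M *ᵥ x := by
  classical
  set V : Submodule ℝ (EuclideanSpace ℝ J) := LinearMap.range (Matrix.toLpLin 2 2 M)
  obtain ⟨P, hP⟩ : ∃ P : Matrix J J ℝ, ∀ v, P *ᵥ v = (V.starProjection (WithLp.toLp 2 v)).ofLp :=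
    ⟨(Matrix.toLpLin 2 2).symm V.starProjection.toLinearMap, fun v => by
      rw [← Matrix.toLin'_apply, ← Matrix.ofLp_toLpLin 2 2, LinearEquiv.apply_symm_apply]
      rfl⟩
  refine ⟨P, ?_, ?_, fun v => ?_⟩
  · ext i k
    have hentry (a b : J) : P a b = (P *ᵥ Pi.single b 1) a := by simp
    have hinner : inner ℝ (V.starProjection (WithLp.toLp 2 (Pi.single k 1)))
        (V.starProjection (WithLp.toLp 2 (Pi.single i 1))) = P i k := by
      rw [← V.inner_starProjection_left_eq_right, V.starProjection_eq_self_iff.2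
        (V.starProjection_apply_mem _), hentry, hP]
      simp [PiLp.inner_apply]
    rw [← hinner, PiLp.inner_apply, Matrix.mul_apply]
    simp [← hP]
  · refine Matrix.ext_of_mulVec_single fun c => ?_
    have hmem : WithLp.toLp 2 (M *ᵥ Pi.single c 1) ∈ V := ⟨WithLp.toLp 2 (Pi.single c 1), rfl⟩
    rw [← Matrix.mulVec_mulVec, hP, V.starProjection_eq_self_iff.2 hmem]
  · obtain ⟨x, hx⟩ := V.starProjection_apply_mem (WithLp.toLp 2 v)
    exact ⟨x.ofLp, by rw [hP, ← hx, Matrix.ofLp_toLpLin, Matrix.toLin'_apply]⟩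

lemma sum_sq_col_eq_diag {P : Matrix J J ℝ} (hP : Pᵀ * P = P) (i : J) :
    ∑ j, P j i ^ 2 = P i i := by
  nth_rw 2 [← hP]
  simp [Matrix.mul_apply, sq]

namespace IsLewisOverestimate

variable {B : Matrix J m ℝ} {u : J → ℝ}

lemma mulVec_eq_zero (h : IsLewisOverestimate B u) {j : J} (hj : u j = 0) (x : m → ℝ) :
    (B *ᵥ x) j = 0 := by
  have := h.sq_le j x
  rw [hj, zero_pow two_ne_zero, zero_mul] at this
  exact pow_eq_zero_iff two_ne_zero |>.1 (this.antisymm (sq_nonneg _))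

lemma row_eq_zero (h : IsLewisOverestimate B u) {j : J} (hj : u j = 0) : B j = 0 := by
  classical
  ext c
  simpa using h.mulVec_eq_zero hj (Pi.single c 1)

lemma abs_mulVec_le (h : IsLewisOverestimate B u) (j : J) (x : m → ℝ) :
    |(B *ᵥ x) j| ≤ u j * ∑ i, |(B *ᵥ x) i| := by
  set y := B *ᵥ x
  set Q := ∑ i, (u i)⁻¹ * y i ^ 2 with hQ
  have hu := h.nonneg
  have hQ0 : 0 ≤ Q := Finset.sum_nonneg fun i _ => mul_nonneg (inv_nonneg.2 (hu i)) (sq_nonneg _)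
  have hy (i : J) : |y i| ≤ u i * √Q := by
    refine abs_le_of_sq_le_sq ?_ (mul_nonneg (hu i) (Real.sqrt_nonneg _))
    rw [mul_pow, Real.sq_sqrt hQ0]
    exact h.sq_le i x
  have hself : √Q * √Q ≤ (∑ i, |y i|) * √Q := by
    rw [Real.mul_self_sqrt hQ0, hQ, Finset.sum_mul]
    refine Finset.sum_le_sum fun i _ => ?_
    rcases (hu i).eq_or_lt with hi | hi
    · rw [← hi, inv_zero, zero_mul]
      positivity
    · rw [inv_mul_le_iff₀ hi, ← sq_abs, sq, mul_left_comm]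
      gcongr
      exact hy i
  have hQs : √Q ≤ ∑ i, |y i| := by
    rcases (Real.sqrt_nonneg Q).eq_or_lt with hQ_zero | hQ_pos
    · rw [← hQ_zero]
      positivity
    · exact le_of_mul_le_mul_right hself hQ_pos
  exact (hy j).trans (mul_le_mul_of_nonneg_left hQs (hu j))

lemma abs_apply_le (h : IsLewisOverestimate B u) (j : J) (c : m) :
    |B j c| ≤ u j * ∑ i, |B i c| := by
  classical
  simpa using h.abs_mulVec_le j (Pi.single c 1)

lemma mul {m' : Type*} [Fintype m'] (h : IsLewisOverestimate B u) (X : Matrix m m' ℝ) :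
    IsLewisOverestimate (B * X) u where
  nonneg := h.nonneg
  sq_le j x := by simpa only [← Matrix.mulVec_mulVec] using h.sq_le j (X *ᵥ x)

lemma fromRows_smul {K : Type*} [Fintype K] (h : IsLewisOverestimate B u) (f : K → J) {t : K → ℝ}
    (ht : ∀ k, 0 ≤ t k) :
    IsLewisOverestimate (Matrix.fromRows B (Matrix.of fun k => t k • B (f k)))
      (Sum.elim u fun k => t k * u (f k)) := by
  have hu := h.nonneg
  have hrow (k : K) (x : m → ℝ) :
      (Matrix.of (fun k => t k • B (f k)) *ᵥ x) k = t k * (B *ᵥ x) (f k) :=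
    smul_dotProduct (t k) (B (f k)) x
  have hform (x : m → ℝ) : ∑ i, (u i)⁻¹ * (B *ᵥ x) i ^ 2 ≤
      ∑ i, (Sum.elim u (fun k => t k * u (f k)) i)⁻¹ *
        (Matrix.fromRows B (Matrix.of fun k => t k • B (f k)) *ᵥ x) i ^ 2 := by
    rw [Matrix.fromRows_mulVec, Fintype.sum_sum_type]
    refine le_add_of_nonneg_right (Finset.sum_nonneg fun k _ => ?_)
    exact mul_nonneg (inv_nonneg.2 (mul_nonneg (ht k) (hu _))) (sq_nonneg _)
  refine ⟨?_, ?_⟩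
  · rintro (j | k)
    exacts [hu j, mul_nonneg (ht k) (hu _)]
  · rintro (j | k) x
    · refine le_trans ?_ (mul_le_mul_of_nonneg_left (hform x) (sq_nonneg _))
      simpa [Matrix.fromRows_mulVec] using h.sq_le j x
    · refine le_trans ?_ (mul_le_mul_of_nonneg_left (hform x) (sq_nonneg _))
      simp only [Matrix.fromRows_mulVec, Sum.elim_inr, hrow, mul_pow, mul_assoc]
      exact mul_le_mul_of_nonneg_left (h.sq_le (f k) x) (sq_nonneg _)

lemma diag_projection_le (h : IsLewisOverestimate B u) {P : Matrix J J ℝ} (hP : Pᵀ * P = P)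
    (hrange : ∀ v, ∃ x, P *ᵥ v = (Matrix.of fun j => (√(u j))⁻¹ • B j) *ᵥ x)
    (i : J) : P i i ≤ u i := by
  classical
  have hu := h.nonneg
  have hdiag_sq : P i i ^ 2 ≤ u i * P i i := by
    obtain ⟨x, hx⟩ := hrange (Pi.single i 1)
    have hPx (j : J) : P j i ^ 2 = (u j)⁻¹ * (B *ᵥ x) j ^ 2 := by
      have hscale := (congrFun hx j).trans (smul_dotProduct (√(u j))⁻¹ (B j) x)
      rw [Matrix.mulVec_single_one, Matrix.col_apply] at hscale
      rw [hscale, smul_eq_mul, ← Matrix.mulVec, mul_pow, inv_pow, Real.sq_sqrt (hu j)]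
    rw [hPx, ← sum_sq_col_eq_diag hP]
    simp_rw [hPx]
    rcases (hu i).eq_or_lt with hi | hi
    · simp [← hi]
    · rw [inv_mul_le_iff₀ hi, ← mul_assoc, ← sq]
      exact h.sq_le i x
  have hdiag_nonneg : 0 ≤ P i i := by
    rw [← sum_sq_col_eq_diag hP]
    positivity
  rcases hdiag_nonneg.eq_or_lt with hi | hi
  · exact hi ▸ hu i
  · exact le_of_mul_le_mul_right (by simpa [sq] using hdiag_sq) hi

/- With `M = U^(-1/2) B` and `P` the orthogonal projection onto its column space, `M = P M` gives
`R = P U^(-1/2)`, and the leverage score `P i i` is at most `u i`. -/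
theorem exists_reproducing (h : IsLewisOverestimate B u) :
    ∃ R : Matrix J J ℝ, (∀ j, B j = ∑ i, (√(u j) * R j i) • B i) ∧ ∀ i, ∑ j, R j i ^ 2 ≤ 1 := by
  classical
  have hu := h.nonneg
  obtain ⟨P, hPP, hPM, hrange⟩ :=
    exists_orthogonal_projection_matrix (Matrix.of fun j => (√(u j))⁻¹ • B j)
  refine ⟨Matrix.of fun j i => P j i * (√(u i))⁻¹, fun j => ?_, fun i => ?_⟩
  · rcases (hu j).eq_or_lt with hj | hj
    · simp [h.row_eq_zero hj.symm, ← hj]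
    · ext c
      have hfix := congrFun₂ hPM j c
      simp only [Matrix.mul_apply, Matrix.of_apply, Pi.smul_apply, smul_eq_mul] at hfix
      rw [eq_inv_mul_iff_mul_eq₀ (Real.sqrt_pos.2 hj).ne'] at hfix
      simp [Finset.sum_apply, ← hfix, Finset.mul_sum, mul_assoc]
  · simp_rw [Matrix.of_apply, mul_pow, ← Finset.sum_mul, sum_sq_col_eq_diag hPP, inv_pow,
      Real.sq_sqrt (hu i)]
    exact mul_inv_le_one_of_le₀ (h.diag_projection_le hPP hrange i) (hu i)

lemma norm_sum_smul_pow_le (h : IsLewisOverestimate B u) (c : J → ℝ) {q : ℕ} (hq : q ≠ 0) :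
    ‖∑ i, c i • B i‖ ^ (2 * q) ≤ ‖∑ j, |B j|‖ ^ (2 * q) * ∑ i, u i * c i ^ (2 * q) := by
  have hnonneg : 0 ≤ ∑ i, u i * c i ^ (2 * q) :=
    Finset.sum_nonneg fun i _ => mul_nonneg (h.nonneg i) (by rw [pow_mul]; positivity)
  refine pi_norm_pow_le (by positivity) (by omega) fun b => ?_
  have hle := abs_sum_mul_pow_le (h.abs_apply_le · b) c (l := 2 * q) (by omega)
  simp_rw [Even.pow_abs (even_two_mul q) (c _)] at hle
  simp only [Finset.sum_apply, Pi.smul_apply, smul_eq_mul]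
  refine hle.trans ?_
  gcongr
  simpa using (le_abs_self _).trans (norm_le_pi_norm (∑ j, |B j|) b)

theorem expect_norm_sum_sign_smul_pow_le {K : Type*} [Fintype K] [DecidableEq K]
    (h : IsLewisOverestimate B u) (f : K ↪ J) {η : ℝ} (hη : 0 ≤ η) (hf : ∀ k, u (f k) ≤ η) {q : ℕ}
    (hq : q ≠ 0) :
    𝔼 σ : K → ℤˣ, ‖∑ k, σ k • B (f k)‖ ^ (2 * q) ≤
      ‖∑ j, |B j|‖ ^ (2 * q) * ((∑ j, u j) * (2 * q * Real.exp 1 * η) ^ q) := by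
  obtain ⟨R, hB, hR⟩ := h.exists_reproducing
  set coeff : (K → ℤˣ) → J → ℝ := fun σ i => ∑ k, σ k • (√(u (f k)) * R (f k) i) with hcoeff
  have hrep (σ : K → ℤˣ) : ∑ k, σ k • B (f k) = ∑ i, coeff σ i • B i := by
    simp_rw [hB (f _), hcoeff, Finset.smul_sum, Finset.sum_smul, smul_assoc]
    exact Finset.sum_comm
  have hmoment (i : J) : 𝔼 σ, coeff σ i ^ (2 * q) ≤ (2 * q * Real.exp 1 * η) ^ q := by
    refine (expect_sum_sign_smul_pow_le q _).trans ?_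
    gcongr
    calc ∑ k, (√(u (f k)) * R (f k) i) ^ 2 ≤ ∑ k, η * R (f k) i ^ 2 := by
          gcongr with k
          rw [mul_pow, Real.sq_sqrt (h.nonneg _)]
          gcongr
          exact hf k
      _ ≤ η * ∑ j, R j i ^ 2 := by
          rw [← Finset.mul_sum, ← Finset.sum_map Finset.univ f fun j => R j i ^ 2]
          gcongr
          exact Finset.subset_univ _
      _ ≤ η := mul_le_of_le_one_right hη (hR i)
  calc 𝔼 σ : K → ℤˣ, ‖∑ k, σ k • B (f k)‖ ^ (2 * q)
      ≤ 𝔼 σ : K → ℤˣ, ‖∑ j, |B j|‖ ^ (2 * q) * ∑ i, u i * coeff σ i ^ (2 * q) :=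
        Finset.expect_le_expect fun σ _ => hrep σ ▸ h.norm_sum_smul_pow_le _ hq
    _ = ‖∑ j, |B j|‖ ^ (2 * q) * ∑ i, u i * 𝔼 σ, coeff σ i ^ (2 * q) := by
        simp_rw [← Finset.mul_expect, Finset.expect_sum_comm, ← Finset.mul_expect]
    _ ≤ ‖∑ j, |B j|‖ ^ (2 * q) * ((∑ j, u j) * (2 * q * Real.exp 1 * η) ^ q) := by
        rw [Finset.sum_mul]
        gcongr with i
        · exact h.nonneg i
        · exact hmoment i

end IsLewisOverestimate

end LewisOverestimate

section Deviation

variable {J ι τ : Type*} [Fintype J] [Fintype τ]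

/-- The error of the sampled column `ℓ₁` norms of `C`: the `k`-th draw contributes row `r k`, scaled
by the inverse of its sampling value. The `i`-th entry compares the `i`-th columns, so a family of
vectors `C x` is handled by passing to the matrix whose columns they are. -/
noncomputable def sampleDeviation (p : J → ℝ) (C : Matrix J ι ℝ) (r : τ → J) : ι → ℝ :=
  ∑ k, |(p (r k))⁻¹ • C (r k)| - ∑ j, |C j|

lemma sum_div_card_eq_one [Nonempty τ] {p : J → ℝ} (hsum : ∑ j, p j = Fintype.card τ) :
    ∑ j, p j / (Fintype.card τ : ℝ) = 1 := by
  rw [← Finset.sum_div, hsum, div_self (by simp)]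

variable [DecidableEq τ] {C : Matrix J ι ℝ} {w p : J → ℝ} {η : ℝ}

lemma iidMean_sum_abs_inv_smul [Nonempty τ] (hp : ∀ j, 0 ≤ p j) (hsum : ∑ j, p j = Fintype.card τ)
    (hC : ∀ j, p j = 0 → C j = 0) :
    iidMean (fun j => p j / Fintype.card τ) (fun r : τ → J => ∑ k, |(p (r k))⁻¹ • C (r k)|) =
      ∑ j, |C j| := by
  have hN : (Fintype.card τ : ℝ) ≠ 0 := by simp
  rw [iidMean_sum (sum_div_card_eq_one hsum) fun j => |(p j)⁻¹ • C j|,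
    ← Nat.cast_smul_eq_nsmul ℝ, Finset.smul_sum]
  refine Finset.sum_congr rfl fun j _ => ?_
  rw [smul_smul, mul_div_cancel₀ _ hN]
  rcases (hp j).eq_or_lt with hj | hj
  · simp [hC j hj.symm]
  · ext i
    simp [abs_mul, abs_of_pos hj, hj.ne']

variable [Fintype ι]

lemma IsLewisOverestimate.expect_norm_sum_sign_smul_sample_le (h : IsLewisOverestimate C w)
    (hp : ∀ j, 0 ≤ p j) (hw : ∀ j, w j ≤ η * p j) (hη : 0 ≤ η)
    (hsum : ∑ j, p j = Fintype.card τ) (hC : ‖∑ j, |C j|‖ ≤ 1) (r : τ → J) {q : ℕ} (hq : q ≠ 0) :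
    𝔼 σ : τ → ℤˣ, ‖∑ k, σ k • (p (r k))⁻¹ • C (r k)‖ ^ (2 * q) ≤
      (2 + ‖sampleDeviation p C r‖) ^ (2 * q) *
        (2 * η * Fintype.card τ * (2 * q * Real.exp 1 * η) ^ q) := by
  set B := Matrix.fromRows C (Matrix.of fun k => (p (r k))⁻¹ • C (r k))
  set u := Sum.elim w fun k => (p (r k))⁻¹ * w (r k)
  have hB : IsLewisOverestimate B u := h.fromRows_smul r fun k => inv_nonneg.2 (hp _)
  have hsample (k : τ) : (p (r k))⁻¹ * w (r k) ≤ η := by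
    rcases (hp (r k)).eq_or_lt with hk | hk
    · simpa [← hk] using hη
    · rw [inv_mul_le_iff₀ hk, mul_comm]
      exact hw _
  have hsum_u : ∑ j, u j ≤ 2 * η * Fintype.card τ := by
    calc ∑ j, u j ≤ ∑ j, η * p j + ∑ _k : τ, η := by
          rw [Fintype.sum_sum_type]
          exact add_le_add (Finset.sum_le_sum fun j _ => hw j)
            (Finset.sum_le_sum fun k _ => hsample k)
      _ = 2 * η * Fintype.card τ := by
          rw [← Finset.mul_sum, hsum, Finset.sum_const, Finset.card_univ, nsmul_eq_mul]
          ring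
  have hnorm : ‖∑ j, |B j|‖ ≤ 2 + ‖sampleDeviation p C r‖ := by
    have hrows : ∑ j, |B j| = ∑ j, |C j| + ∑ j, |C j| + sampleDeviation p C r := by
      rw [Fintype.sum_sum_type, sampleDeviation, add_assoc, add_sub_cancel]
      rfl
    rw [hrows]
    refine (norm_add₃_le).trans ?_
    linarith
  refine (hB.expect_norm_sum_sign_smul_pow_le .inr hη hsample hq).trans ?_
  have : 0 ≤ ∑ j, u j := Finset.sum_nonneg fun j _ => hB.nonneg j
  gcongr

lemma IsLewisOverestimate.expect_norm_sum_sign_smul_abs_sample_le (h : IsLewisOverestimate C w)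
    (hp : ∀ j, 0 ≤ p j) (hw : ∀ j, w j ≤ η * p j) (hη : 0 ≤ η)
    (hsum : ∑ j, p j = Fintype.card τ) (hC : ‖∑ j, |C j|‖ ≤ 1) (r : τ → J) {q : ℕ} (hq : q ≠ 0) :
    𝔼 σ : τ → ℤˣ, ‖∑ k, σ k • |(p (r k))⁻¹ • C (r k)|‖ ^ (2 * q) ≤
      2 * η * Fintype.card τ * (8 * q * Real.exp 1 * η) ^ q *
        (4 ^ q + ‖sampleDeviation p C r‖ ^ (2 * q)) := by
  set b := 2 * η * Fintype.card τ * (2 * q * Real.exp 1 * η) ^ q with hb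
  calc 𝔼 σ : τ → ℤˣ, ‖∑ k, σ k • |(p (r k))⁻¹ • C (r k)|‖ ^ (2 * q)
      ≤ 2 * 𝔼 σ : τ → ℤˣ, ‖∑ k, σ k • (p (r k))⁻¹ • C (r k)‖ ^ (2 * q) :=
        expect_norm_sum_sign_smul_abs_pow_le (fun k => (p (r k))⁻¹ • C (r k)) (2 * q)
    _ ≤ 2 * ((2 + ‖sampleDeviation p C r‖) ^ (2 * q) * b) := by
        gcongr
        exact h.expect_norm_sum_sign_smul_sample_le hp hw hη hsum hC r hq
    _ ≤ 2 * (2 ^ (2 * q) * ((2 ^ (2 * q) + ‖sampleDeviation p C r‖ ^ (2 * q)) / 2) * b) := by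
        gcongr
        exact add_pow_le_two_pow_mul zero_le_two (norm_nonneg _) _
    _ = 2 * η * Fintype.card τ * (4 * (2 * q * Real.exp 1 * η)) ^ q *
          (4 ^ q + ‖sampleDeviation p C r‖ ^ (2 * q)) := by
        rw [hb, pow_mul, mul_pow (4 : ℝ) (2 * q * Real.exp 1 * η)]
        norm_num
        ring
    _ = _ := by ring

theorem IsLewisOverestimate.iidMean_norm_sampleDeviation_pow_le_add [Nonempty τ]
    (h : IsLewisOverestimate C w) (hp : ∀ j, 0 ≤ p j) (hw : ∀ j, w j ≤ η * p j) (hη : 0 ≤ η)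
    (hsum : ∑ j, p j = Fintype.card τ) (hC : ‖∑ j, |C j|‖ ≤ 1) {q : ℕ} (hq : q ≠ 0) :
    iidMean (fun j => p j / Fintype.card τ)
        (fun r : τ → J => ‖sampleDeviation p C r‖ ^ (2 * q)) ≤
      2 * η * Fintype.card τ * (32 * q * Real.exp 1 * η) ^ q *
        (4 ^ q + iidMean (fun j => p j / Fintype.card τ)
          (fun r : τ → J => ‖sampleDeviation p C r‖ ^ (2 * q))) := by
  set P : J → ℝ := fun j => p j / Fintype.card τ
  set b := 2 * η * Fintype.card τ * (8 * q * Real.exp 1 * η) ^ q with hb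
  set F : (τ → J) → ℝ := fun r => ‖sampleDeviation p C r‖ ^ (2 * q)
  have hP (j : J) : 0 ≤ P j := div_nonneg (hp j) (by positivity)
  have hP1 : ∑ j, P j = 1 := sum_div_card_eq_one hsum
  have hC0 (j : J) (hj : p j = 0) : C j = 0 :=
    h.row_eq_zero (le_antisymm (by simpa [hj] using hw j) (h.nonneg j))
  calc iidMean P F
      ≤ 2 ^ (2 * q) * iidMean P (fun r : τ → J =>
          𝔼 σ : τ → ℤˣ, ‖∑ k, σ k • |(p (r k))⁻¹ • C (r k)|‖ ^ (2 * q)) := by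
        have := iidMean_norm_sum_sub_mean_pow_le (τ := τ) hP hP1 (fun j => |(p j)⁻¹ • C j|) (2 * q)
        rwa [iidMean_sum_abs_inv_smul hp hsum hC0] at this
    _ ≤ 2 ^ (2 * q) * iidMean P (b • ((fun _ => 4 ^ q) + F)) := by
        gcongr
        exact iidMean_mono hP fun r =>
          h.expect_norm_sum_sign_smul_abs_sample_le hp hw hη hsum hC r hq
    _ = 2 * η * Fintype.card τ * (4 * (8 * q * Real.exp 1 * η)) ^ q * (4 ^ q + iidMean P F) := by
        rw [map_smul, map_add, iidMean_const hP1, smul_eq_mul, hb, pow_mul,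
          mul_pow (4 : ℝ) (8 * q * Real.exp 1 * η)]
        norm_num
        ring
    _ = _ := by ring

lemma IsLewisOverestimate.iidMean_norm_sampleDeviation_pow_le [Nonempty τ]
    (h : IsLewisOverestimate C w) (hp : ∀ j, 0 ≤ p j) (hw : ∀ j, w j ≤ η * p j) (hη : 0 ≤ η)
    (hsum : ∑ j, p j = Fintype.card τ) (hC : ‖∑ j, |C j|‖ ≤ 1) {q : ℕ} (hq : q ≠ 0)
    (hsmall : 2 * η * Fintype.card τ * (32 * q * Real.exp 1 * η) ^ q ≤ 1 / 2) :
    iidMean (fun j => p j / Fintype.card τ)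
        (fun r : τ → J => ‖sampleDeviation p C r‖ ^ (2 * q)) ≤
      4 * η * Fintype.card τ * (128 * q * Real.exp 1 * η) ^ q := by
  have hrec := h.iidMean_norm_sampleDeviation_pow_le_add hp hw hη hsum hC hq
  set M := iidMean (fun j => p j / Fintype.card τ)
    (fun r : τ → J => ‖sampleDeviation p C r‖ ^ (2 * q))
  have hM : 0 ≤ M := by
    rw [← map_zero (iidMean (τ := τ) fun j => p j / (Fintype.card τ : ℝ))]
    exact iidMean_mono (fun j => div_nonneg (hp j) (by positivity)) fun r => by
      rw [Pi.zero_apply]; positivity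
  have hhalf := mul_le_mul_of_nonneg_right hsmall hM
  rw [show 128 * q * Real.exp 1 * η = 4 * (32 * q * Real.exp 1 * η) by ring, mul_pow 4]
  linarith

end Deviation

section Tail

variable {J m τ : Type*} [Fintype J] [Fintype m] [Fintype τ] {A : Matrix J m ℝ}
  {w p : J → ℝ} {η δ : ℝ}

lemma sum_abs_mul_apply {ι : Type*} (A : Matrix J m ℝ) (X : Matrix m ι ℝ) (i : ι) :
    (∑ j, |(A * X) j|) i = ∑ j, |(A *ᵥ Xᵀ i) j| := by
  simp [Finset.sum_apply, Matrix.mul_apply, Matrix.mulVec, dotProduct]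

lemma sampleDeviation_mul_apply {ι : Type*} (X : Matrix m ι ℝ) (r : τ → J) (i : ι) :
    sampleDeviation p (A * X) r i =
      ∑ k, |(p (r k))⁻¹ * (A *ᵥ Xᵀ i) (r k)| - ∑ j, |(A *ᵥ Xᵀ i) j| := by
  simp [sampleDeviation, Finset.sum_apply, Matrix.mul_apply, Matrix.mulVec, dotProduct]

variable [DecidableEq τ]

lemma iidMean_indicator_le_one {κ : Type*} [Fintype κ] {P : κ → ℝ} (hP : ∀ j, 0 ≤ P j)
    (hP1 : ∑ j, P j = 1) (T : Set (τ → κ)) : iidMean P (T.indicator 1) ≤ (1 : ℝ) :=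
  (iidMean_mono hP (Set.indicator_le_self' fun _ _ => zero_le_one)).trans_eq
    (iidMean_const hP1 1)

lemma iidMean_markov {κ : Type*} [Fintype κ] {P : κ → ℝ} (hP : ∀ j, 0 ≤ P j) {T : Set (τ → κ)}
    {F : (τ → κ) → ℝ} (hF : ∀ r, 0 ≤ F r) {a : ℝ} (hT : ∀ r ∈ T, a ≤ F r) :
    a * iidMean P (T.indicator 1) ≤ iidMean P F := by
  rw [← smul_eq_mul, ← map_smul]
  refine iidMean_mono hP fun r => ?_
  by_cases hr : r ∈ T
  · simpa [hr] using hT r hr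
  · simpa [hr] using hF r

/- The test vectors of the bad samples are the columns of a matrix `X`, so that a single moment
bound, for `A * X`, controls all bad samples at once. -/
theorem IsLewisOverestimate.iidMean_indicator_le [Nonempty τ] (h : IsLewisOverestimate A w)
    (hp : ∀ j, 0 ≤ p j) (hw : ∀ j, w j ≤ η * p j) (hη : 0 ≤ η) (hsum : ∑ j, p j = Fintype.card τ)
    (hδ : 0 < δ) (hδ1 : δ ≤ 1) {T : Set (τ → J)}
    (hT : ∀ r ∈ T, ∃ x, ∑ j, |(A *ᵥ x) j| ≤ 1 ∧
      δ ≤ |∑ k, |(p (r k))⁻¹ * (A *ᵥ x) (r k)| - (∑ j, |(A *ᵥ x) j|)|) {q : ℕ} (hq : q ≠ 0) :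
    iidMean (fun j => p j / Fintype.card τ) (T.indicator 1) ≤
      4 * η * Fintype.card τ * (128 * q * Real.exp 1 * η / δ ^ 2) ^ q := by
  classical
  have hP (j : J) : 0 ≤ p j / Fintype.card τ := div_nonneg (hp j) (by positivity)
  have hP1 := sum_div_card_eq_one hsum
  rcases le_total 1 (4 * η * Fintype.card τ * (128 * q * Real.exp 1 * η / δ ^ 2) ^ q)
    with hlarge | hsmall
  · exact (iidMean_indicator_le_one hP hP1 T).trans hlarge
  choose! x hx1 hxδ using hT
  set X : Matrix m (τ → J) ℝ := Matrix.of fun c s => if s ∈ T then x s c else 0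
  have hX {s : τ → J} (hs : s ∈ T) : Xᵀ s = x s := by ext; simp [X, hs]
  have hX0 {s : τ → J} (hs : s ∉ T) : Xᵀ s = 0 := by ext; simp [X, hs]
  have hnorm : ‖∑ j, |(A * X) j|‖ ≤ 1 := by
    refine (pi_norm_le_iff_of_nonneg zero_le_one).2 fun s => ?_
    rw [sum_abs_mul_apply, Real.norm_of_nonneg (by positivity)]
    by_cases hs : s ∈ T
    · exact hX hs ▸ hx1 s hs
    · simp [hX0 hs]
  have hdev (r : τ → J) (hr : r ∈ T) : δ ^ (2 * q) ≤ ‖sampleDeviation p (A * X) r‖ ^ (2 * q) := by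
    gcongr
    refine le_trans ?_ (norm_le_pi_norm (sampleDeviation p (A * X) r) r)
    rw [sampleDeviation_mul_apply, hX hr]
    exact hxδ r hr
  have hmoment := (h.mul X).iidMean_norm_sampleDeviation_pow_le hp hw hη hsum hnorm hq ?_
  · have hmarkov := (iidMean_markov hP (fun r => by positivity) hdev).trans hmoment
    rw [div_pow, ← pow_mul, ← mul_div_assoc, le_div_iff₀' (by positivity)]
    exact hmarkov
  · calc 2 * η * Fintype.card τ * (32 * q * Real.exp 1 * η) ^ q
        ≤ 2 * η * Fintype.card τ * (128 * q * Real.exp 1 * η / δ ^ 2) ^ q := by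
          gcongr
          rw [le_div_iff₀ (by positivity)]
          refine (mul_le_of_le_one_right (by positivity) (pow_le_one₀ hδ.le hδ1)).trans ?_
          gcongr
          norm_num
      _ ≤ 1 / 2 := by linarith

end Tail

section LewisWeights

variable {n d : ℕ} {A : Matrix (Fin n) (Fin d) ℝ} {w : Fin n → ℝ}

lemma dotProduct_lewisForm_mulVec (A : Matrix (Fin n) (Fin d) ℝ) (w : Fin n → ℝ)
    (x y : Fin d → ℝ) :
    x ⬝ᵥ (lewisForm A w *ᵥ y) = ∑ i, (w i)⁻¹ * ((A *ᵥ x) i * (A *ᵥ y) i) := by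
  rw [lewisForm, ← Matrix.mulVec_mulVec, ← Matrix.mulVec_mulVec, Matrix.dotProduct_mulVec,
    Matrix.vecMul_transpose]
  refine Finset.sum_congr rfl fun i _ => ?_
  rw [Matrix.mulVec_diagonal, mul_left_comm]

namespace IsL1LewisWeights

/- With `Q = Aᵀ W⁻¹ A` and `z = Q⁻¹ aᵢ`, the scalar `aᵢᵀ x` is the `Q`-inner product of `z` and `x`,
and `wᵢ²` is that of `z` with itself. -/
theorem isLewisOverestimate (h : IsL1LewisWeights A w) : IsLewisOverestimate A w where
  nonneg := h.nonneg
  sq_le i x := by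
    set z := (lewisForm A w)⁻¹ *ᵥ A i with hz
    have hdual (y : Fin d → ℝ) :
        (A *ᵥ y) i = ∑ j, (w j)⁻¹ * ((A *ᵥ y) j * (A *ᵥ z) j) := by
      rw [← dotProduct_lewisForm_mulVec, hz, Matrix.mulVec_mulVec,
        Matrix.mul_nonsing_inv _ h.isUnit_det, Matrix.one_mulVec, dotProduct_comm]
      rfl
    have hw : w i ^ 2 = ∑ j, (w j)⁻¹ * (A *ᵥ z) j ^ 2 := by
      simp_rw [sq (Matrix.mulVec _ _ _), ← h.row_eq i]
      exact hdual z
    have hnonneg (y : Fin d → ℝ) (j : Fin n) : 0 ≤ (w j)⁻¹ * (A *ᵥ y) j ^ 2 :=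
      mul_nonneg (inv_nonneg.2 (h.nonneg j)) (sq_nonneg _)
    rw [hw, mul_comm, hdual x]
    exact Finset.sum_sq_le_sum_mul_sum_of_sq_le_mul _ (fun j _ => hnonneg x j)
      (fun j _ => hnonneg z j) fun j _ => le_of_eq (by ring)

theorem sum_eq (h : IsL1LewisWeights A w) : ∑ i, w i = d := by
  have hrow (i : Fin n) : w i = (w i)⁻¹ * (A * ((lewisForm A w)⁻¹ * Aᵀ)) i i := by
    have hdiag : (A * ((lewisForm A w)⁻¹ * Aᵀ)) i i = w i ^ 2 := by
      rw [← h.row_eq i, Matrix.mul_apply]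
      simp only [dotProduct, Matrix.mulVec, Matrix.mul_apply, Matrix.transpose_apply]
    rw [hdiag, sq, mul_comm, mul_self_mul_inv]
  calc ∑ i, w i = (Matrix.diagonal (fun i => (w i)⁻¹) *
        (A * ((lewisForm A w)⁻¹ * Aᵀ))).trace := by
        simp_rw [Matrix.trace, Matrix.diag_apply, Matrix.diagonal_mul, ← hrow]
    _ = (lewisForm A w * (lewisForm A w)⁻¹).trace := by
        rw [← Matrix.mul_assoc, ← Matrix.mul_assoc, Matrix.trace_mul_comm, ← Matrix.mul_assoc,
          ← Matrix.mul_assoc, lewisForm]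
    _ = d := by rw [Matrix.mul_nonsing_inv _ h.isUnit_det, Matrix.trace_one, Fintype.card_fin]

lemma one_le_sum (h : IsL1LewisWeights A w) (hd : d ≠ 0) : 1 ≤ ∑ i, w i := by
  rw [h.sum_eq]
  exact_mod_cast Nat.one_le_iff_ne_zero.2 hd

end IsL1LewisWeights

end LewisWeights

section Sampling

lemma l1norm_eq_sum_abs {m : ℕ} (v : Fin m → ℝ) : l1norm v = ∑ i, |v i| :=
  PiLp.norm_eq_of_L1 _

lemma ApproxFactor.of_abs_sub_le {ε s t : ℝ} (hε : 0 ≤ ε) (hε1 : ε ≤ 1) (ht : 0 ≤ t)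
    (h : |s - t| ≤ ε / 2 * t) : ApproxFactor (1 + ε) s t := by
  obtain ⟨hlower, hupper⟩ := abs_le.1 h
  have : 0 ≤ ε * t := by positivity
  constructor
  · rw [one_div, inv_mul_le_iff₀ (by linarith)]
    linarith
  · have : 0 ≤ ε * (1 - ε) * t := mul_nonneg (mul_nonneg hε (by linarith)) ht
    calc t ≤ (1 + ε) * ((1 - ε / 2) * t) := by linarith
      _ ≤ (1 + ε) * s := by gcongr; linarith

variable {n d N : ℕ} {A : Matrix (Fin n) (Fin d) ℝ} {p : Fin n → ℝ} {ε : ℝ}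

lemma l1norm_samplingMatrix_mul_mulVec (p : Fin n → ℝ) (r : Fin N → Fin n)
    (A : Matrix (Fin n) (Fin d) ℝ) (x : Fin d → ℝ) :
    l1norm ((samplingMatrix p r * A) *ᵥ x) = ∑ k, |(p (r k))⁻¹ * (A *ᵥ x) (r k)| := by
  simp_rw [l1norm_eq_sum_abs, ← Matrix.mulVec_mulVec, ← one_div]
  exact Finset.sum_congr rfl fun k _ => congrArg abs (single_dotProduct _ _ _)

lemma exists_deviation_of_not_preservesL1 {r : Fin N → Fin n} (hε : 0 ≤ ε) (hε1 : ε ≤ 1)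
    (h : ¬ PreservesL1 ε (samplingMatrix p r) A) :
    ∃ x, ∑ j, |(A *ᵥ x) j| ≤ 1 ∧
      ε / 2 ≤ |∑ k, |(p (r k))⁻¹ * (A *ᵥ x) (r k)| - (∑ j, |(A *ᵥ x) j|)| := by
  obtain ⟨x, hx⟩ := not_forall.1 h
  rw [l1norm_samplingMatrix_mul_mulVec, l1norm_eq_sum_abs] at hx
  set t := ∑ j, |(A *ᵥ x) j| with ht
  have ht0 : 0 ≤ t := by positivity
  have hdev : ε / 2 * t < |∑ k, |(p (r k))⁻¹ * (A *ᵥ x) (r k)| - t| :=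
    lt_of_not_ge fun hle => hx (.of_abs_sub_le hε hε1 ht0 hle)
  have htpos : 0 < t := by
    refine ht0.lt_of_ne fun ht_zero => ?_
    have hAx (j : Fin n) : (A *ᵥ x) j = 0 := abs_eq_zero.1
      ((Finset.sum_eq_zero_iff_of_nonneg fun _ _ => abs_nonneg _).1 ht_zero.symm j
        (Finset.mem_univ j))
    simp [← ht_zero, hAx] at hdev
  have habs (b y : ℝ) : |b * (t⁻¹ * y)| = t⁻¹ * |b * y| := by
    rw [mul_left_comm, abs_mul, abs_of_pos (inv_pos.2 htpos)]
  have hnorm : ∑ j, |(A *ᵥ (t⁻¹ • x)) j| = 1 := by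
    simp_rw [Matrix.mulVec_smul, Pi.smul_apply, smul_eq_mul, abs_mul, ← Finset.mul_sum, ← ht,
      abs_of_pos (inv_pos.2 htpos), inv_mul_cancel₀ htpos.ne']
  refine ⟨t⁻¹ • x, hnorm.le, ?_⟩
  simp_rw [hnorm, Matrix.mulVec_smul, Pi.smul_apply, smul_eq_mul, habs, ← Finset.mul_sum]
  rw [← inv_mul_cancel₀ htpos.ne', ← mul_sub, abs_mul, abs_of_pos (inv_pos.2 htpos)]
  exact (le_inv_mul_iff₀' htpos).2 hdev.le

theorem IsRowSampling.measureReal_eq_iidMean {Ω : Type*} [MeasurableSpace Ω] {μ : Measure Ω}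
    [IsFiniteMeasure μ] {idx : Fin N → Ω → Fin n} (h : IsRowSampling μ p idx) (hp : ∀ i, 0 ≤ p i)
    (T : Set (Fin N → Fin n)) :
    μ.real {ω | (fun k => idx k ω) ∈ T} = iidMean (fun i => p i / N) (T.indicator 1) := by
  classical
  have hmeas : Measurable fun ω k => idx k ω := measurable_pi_lambda _ h.measurable
  have hpoint (r : Fin N → Fin n) :
      μ.real ((fun ω k => idx k ω) ⁻¹' {r}) = ∏ k, p (r k) / N := by
    have hinter : (fun ω k => idx k ω) ⁻¹' {r} = ⋂ k ∈ Finset.univ, idx k ⁻¹' {r k} := by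
      ext ω
      simp [funext_iff]
    rw [Measure.real, hinter, h.indep.measure_inter_preimage_eq_mul Finset.univ
      (fun k _ => MeasurableSet.singleton _), ENNReal.toReal_prod]
    exact Finset.prod_congr rfl fun k _ => (congrArg ENNReal.toReal (h.law k (r k))).trans
      (ENNReal.toReal_ofReal (div_nonneg (hp _) N.cast_nonneg))
  calc μ.real {ω | (fun k => idx k ω) ∈ T}
      = ∑ r ∈ T.toFinset, μ.real ((fun ω k => idx k ω) ⁻¹' {r}) := by
        rw [sum_measureReal_preimage_singleton _ fun r _ => hmeas (.singleton r), Set.coe_toFinset]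
        rfl
    _ = iidMean (fun i => p i / N) (T.indicator 1) := by
        simp_rw [hpoint, iidMean_apply, Set.indicator_apply, smul_ite, smul_zero, Pi.one_apply,
          smul_eq_mul, mul_one, ← Finset.sum_filter]
        congr 1
        ext
        simp

lemma IsRowSampling.one_sub_iidMean_le_measureReal {Ω : Type*} [MeasurableSpace Ω] {μ : Measure Ω}
    [IsProbabilityMeasure μ] {idx : Fin N → Ω → Fin n} (h : IsRowSampling μ p idx)
    (hp : ∀ i, 0 ≤ p i) (T : Set (Fin N → Fin n)) :
    1 - iidMean (fun i => p i / N) (Tᶜ.indicator 1) ≤ μ.real {ω | (fun k => idx k ω) ∈ T} := by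
  have hunion : {ω | (fun k => idx k ω) ∈ T} ∪ {ω | (fun k => idx k ω) ∈ Tᶜ} = Set.univ :=
    Set.union_compl_self _
  rw [← h.measureReal_eq_iidMean hp, sub_le_iff_le_add, ← probReal_univ (μ := μ), ← hunion]
  exact measureReal_union_le _ _

end Sampling

section SampleSize

lemma one_half_lt_log {x : ℝ} (hx : 2 ≤ x) : 1 / 2 < Real.log x := by
  have := Real.log_le_log two_pos hx
  linarith [Real.log_two_gt_d9]

lemma exists_moment_order {N : ℕ} (hN : 2 ≤ N) {c : ℝ} (hc : 0 ≤ c) :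
    ∃ q : ℕ, q ≠ 0 ∧ q ≤ (c + 5) * Real.log N ∧
      4 * N * Real.exp (-1) ^ q ≤ (N : ℝ) ^ (-c) := by
  have hNr : (2 : ℝ) ≤ N := by exact_mod_cast hN
  have hN0 : (0 : ℝ) < N := by linarith
  have hlog := one_half_lt_log hNr
  have hpos : 0 < (c + 3) * Real.log N := by positivity
  refine ⟨⌈(c + 3) * Real.log N⌉₊, (Nat.ceil_pos.2 hpos).ne', ?_, ?_⟩
  · linarith [Nat.ceil_lt_add_one hpos.le]
  · have hexp : Real.exp (-1) ^ ⌈(c + 3) * Real.log N⌉₊ ≤ (N : ℝ) ^ (-c) * ((N : ℝ) ^ 3)⁻¹ := by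
      rw [← Real.exp_nat_mul, Real.rpow_def_of_pos hN0, ← Real.exp_log (pow_pos hN0 3),
        ← Real.exp_neg, ← Real.exp_add, Real.log_pow]
      refine Real.exp_le_exp.2 ?_
      push_cast
      linarith [Nat.le_ceil ((c + 3) * Real.log N)]
    calc 4 * N * Real.exp (-1) ^ ⌈(c + 3) * Real.log N⌉₊
        ≤ 2 ^ 2 * N * ((N : ℝ) ^ (-c) * ((N : ℝ) ^ 3)⁻¹) := by
          rw [show (4 : ℝ) = 2 ^ 2 by norm_num]
          gcongr
      _ ≤ N ^ 2 * N * ((N : ℝ) ^ (-c) * ((N : ℝ) ^ 3)⁻¹) := by gcongr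
      _ = (N : ℝ) ^ (-c) := by field_simp

lemma mul_log_le_of_mul_le {β D L N : ℝ} (hβ : 0 < β) (hD : 0 < D) (hL : 1 / 2 ≤ L)
    (hlogD : Real.log D ≤ 2 * L) (hN : (32 * β ^ 2 + 4 * β) * L * D ≤ N) :
    β * D * Real.log N ≤ N := by
  obtain ⟨z, rfl⟩ : ∃ z, N = z * D := ⟨N / D, (div_mul_cancel₀ N hD.ne').symm⟩
  have hz := le_of_mul_le_mul_right hN hD
  have hz0 : 0 < z := lt_of_lt_of_le (by positivity) hz
  have hlogz : Real.log z ≤ 2 * √z := by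
    have := Real.log_le_self (Real.sqrt_nonneg z)
    rw [Real.log_sqrt hz0.le] at this
    linarith
  have hβL : 4 * (β * L) ≤ z := by nlinarith
  have hβz : 4 * (β * √z) ≤ z := by
    have : 4 * β ≤ √z := Real.le_sqrt_of_sq_le (by nlinarith)
    calc 4 * (β * √z) = 4 * β * √z := by ring
      _ ≤ √z * √z := by gcongr
      _ = z := Real.mul_self_sqrt hz0.le
  calc β * D * Real.log (z * D) = β * (Real.log z + Real.log D) * D := by
        rw [Real.log_mul hz0.ne' hD.ne']
        ring
    _ ≤ β * (2 * √z + 2 * L) * D := by gcongr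
    _ ≤ z * D := by gcongr; linarith

lemma mul_log_le_of_sample_size {β s ε N : ℝ} (hβ : 0 < β) (hs : 1 ≤ s) (hε : 0 < ε)
    (hsε : 2 ≤ s / ε)
    (hN : (32 * β ^ 2 + 4 * β) * s * Real.log (s / ε) * (ε ^ 2)⁻¹ ≤ N) :
    β * s * Real.log N * (ε ^ 2)⁻¹ ≤ N := by
  have hD : s * (ε ^ 2)⁻¹ ≤ (s / ε) ^ 2 := by
    rw [div_pow, div_eq_mul_inv]
    gcongr
    exact le_self_pow₀ hs two_ne_zero
  have hlogD : Real.log (s * (ε ^ 2)⁻¹) ≤ 2 * Real.log (s / ε) := by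
    have := Real.log_le_log (by positivity) hD
    rwa [Real.log_pow] at this
  have := mul_log_le_of_mul_le hβ (by positivity) (one_half_lt_log hsε).le hlogD
    (hN.trans_eq' (by ring))
  exact this.trans_eq' (by ring)

lemma mul_le_mul_div_sum_of_approxFactor {ι : Type*} [Fintype ι] {w w' : ι → ℝ} {α β N : ℝ}
    (hα : 0 < α) (hβ : 0 ≤ β) (hw : ∀ i, 0 ≤ w i) (happrox : ∀ i, ApproxFactor α (w i) (w' i))
    (hsum : 0 < ∑ i, w' i) (hN : β * α ^ 2 * ∑ i, w i ≤ N) (i : ι) :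
    β * w i ≤ N * w' i / ∑ j, w' j := by
  have hle (j : ι) : w j ≤ α * w' j := by
    have := (happrox j).1
    rwa [one_div, inv_mul_le_iff₀ hα] at this
  have hw' : 0 ≤ w' i := nonneg_of_mul_nonneg_right ((hw i).trans (hle i)) hα
  rw [le_div_iff₀ hsum]
  calc β * w i * ∑ j, w' j ≤ β * (α * w' i) * (α * ∑ j, w j) := by
        gcongr
        · exact hle i
        · rw [Finset.mul_sum]
          exact Finset.sum_le_sum fun j _ => (happrox j).2
    _ = β * α ^ 2 * (∑ j, w j) * w' i := by ring
    _ ≤ N * w' i := by gcongr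

end SampleSize

/-- The oversampling constant `C_s`. A moment of order `2 q`, where `q ≤ (c + 5) log N`, gives
failure probability `N ^ (-c)`, and the factor `512 e²` makes the base of the moment bound at most
`e⁻¹`. -/
noncomputable def oversamplingConstant (c : ℝ) : ℝ :=
  512 * Real.exp 1 ^ 2 * (c + 5)

lemma oversamplingConstant_pos {c : ℝ} (hc : 0 ≤ c) : 0 < oversamplingConstant c := by
  unfold oversamplingConstant
  positivity

lemma one_le_oversamplingConstant_mul {c L : ℝ} (hc : 0 ≤ c) (hL : 1 / 2 ≤ L) :
    1 ≤ oversamplingConstant c * L := by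
  have he : 1 ≤ Real.exp 1 ^ 2 := one_le_pow₀ (Real.one_le_exp zero_le_one)
  calc (1 : ℝ) ≤ 512 * 1 * (0 + 5) * (1 / 2) := by norm_num
    _ ≤ 512 * Real.exp 1 ^ 2 * (c + 5) * L := by gcongr

lemma moment_base_le_exp_neg_one {c ε L : ℝ} {q : ℕ} (hc : 0 ≤ c) (hε : 0 < ε) (hL : 0 < L)
    (hq : q ≤ (c + 5) * L) :
    128 * q * Real.exp 1 * (ε ^ 2 / (oversamplingConstant c * L)) / (ε / 2) ^ 2 ≤
      Real.exp (-1) := by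
  calc 128 * q * Real.exp 1 * (ε ^ 2 / (oversamplingConstant c * L)) / (ε / 2) ^ 2
      = q / ((c + 5) * L) * Real.exp (-1) := by
        rw [oversamplingConstant, Real.exp_neg]
        field_simp
        ring
    _ ≤ Real.exp (-1) := mul_le_of_le_one_left (Real.exp_pos _).le
        (div_le_one_of_le₀ hq (by positivity))

theorem IsLewisOverestimate.one_sub_rpow_le_measureReal_preservesL1 {n d N : ℕ}
    {A : Matrix (Fin n) (Fin d) ℝ} {w p : Fin n → ℝ} {ε c : ℝ} (h : IsLewisOverestimate A w)
    (hc : 0 ≤ c) (hε : 0 < ε) (hε1 : ε ≤ 1) (hN : 1 ≤ N) (hpN : ∑ i, p i = (N : ℝ))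
    (hwp : ∀ i, oversamplingConstant c * w i * Real.log N * (ε ^ 2)⁻¹ ≤ p i)
    {Ω : Type*} [MeasurableSpace Ω] (μ : Measure Ω) [IsProbabilityMeasure μ]
    {idx : Fin N → Ω → Fin n} (hidx : IsRowSampling μ p idx) :
    1 - (N : ℝ) ^ (-c) ≤
      μ.real {ω | PreservesL1 ε (samplingMatrix p (fun k => idx k ω)) A} := by
  rcases hN.eq_or_lt with rfl | hN2
  · simp
  have : NeZero N := ⟨by omega⟩
  obtain ⟨q, hq, hqL, hqN⟩ := exists_moment_order hN2 hc
  have hlog := one_half_lt_log (x := N) (by exact_mod_cast hN2)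
  have : 0 < Real.log N := by linarith
  have hC := oversamplingConstant_pos hc
  have hp (i : Fin n) : 0 ≤ p i := by
    have := h.nonneg i
    exact (by positivity : (0 : ℝ) ≤ _).trans (hwp i)
  set η := ε ^ 2 / (oversamplingConstant c * Real.log N) with hη
  have hη1 : η ≤ 1 := div_le_one_of_le₀
    ((pow_le_one₀ hε.le hε1).trans (one_le_oversamplingConstant_mul hc hlog.le)) (by positivity)
  have hwη (i : Fin n) : w i ≤ η * p i := by
    refine le_trans (le_of_eq ?_) (mul_le_mul_of_nonneg_left (hwp i) (by positivity))
    rw [hη]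
    field_simp
  refine le_trans ?_
    (hidx.one_sub_iidMean_le_measureReal hp {r | PreservesL1 ε (samplingMatrix p r) A})
  have hbad := h.iidMean_indicator_le (τ := Fin N) hp hwη (by positivity) (by simpa using hpN)
    (half_pos hε) (by linarith) (T := {r | PreservesL1 ε (samplingMatrix p r) A}ᶜ)
    (fun r hr => exists_deviation_of_not_preservesL1 hε.le hε1 hr) hq
  rw [Fintype.card_fin] at hbad
  refine sub_le_sub_left (hbad.trans (le_trans ?_ hqN)) 1
  gcongr
  · linarith
  · exact moment_base_le_exp_neg_one hc hε (by linarith) hqL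

theorem IsLewisOverestimate.one_sub_rpow_le_of_approxFactor {n d N : ℕ}
    {A : Matrix (Fin n) (Fin d) ℝ} {w w' : Fin n → ℝ} {ε c α : ℝ} (h : IsLewisOverestimate A w)
    (hc : 0 ≤ c) (hα : 0 < α) (happrox : ∀ i, ApproxFactor α (w i) (w' i)) (hε : 0 < ε)
    (hε1 : ε ≤ 1) (hw : 1 ≤ ∑ i, w i) (hwε : 2 ≤ (∑ i, w i) / ε)
    (hN : (32 * (oversamplingConstant c * α ^ 2) ^ 2 + 4 * (oversamplingConstant c * α ^ 2)) *
      (∑ i, w i) * Real.log ((∑ i, w i) / ε) * (ε ^ 2)⁻¹ ≤ N)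
    {Ω : Type*} [MeasurableSpace Ω] (μ : Measure Ω) [IsProbabilityMeasure μ]
    {idx : Fin N → Ω → Fin n} (hidx : IsRowSampling μ (fun i => N * w' i / ∑ j, w' j) idx) :
    1 - (N : ℝ) ^ (-c) ≤ μ.real {ω | PreservesL1 ε
      (samplingMatrix (fun i => N * w' i / ∑ j, w' j) (fun k => idx k ω)) A} := by
  have hC := oversamplingConstant_pos hc
  have hsum : 0 < ∑ i, w' i :=
    calc 0 < 1 / α * ∑ i, w i := by positivity
      _ ≤ ∑ i, w' i := by
        rw [Finset.mul_sum]
        exact Finset.sum_le_sum fun i _ => (happrox i).1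
  have hlog : 0 < Real.log ((∑ i, w i) / ε) := Real.log_pos (by linarith)
  have hN0 : (0 : ℝ) < N := lt_of_lt_of_le (by positivity) hN
  have hsize := mul_log_le_of_sample_size (by positivity) hw hε hwε hN
  refine h.one_sub_rpow_le_measureReal_preservesL1 hc hε hε1 (Nat.cast_pos.1 hN0) ?_
    (fun i => ?_) μ hidx
  · rw [← Finset.sum_div, ← Finset.mul_sum, mul_div_cancel_right₀ _ hsum.ne']
  · have := mul_le_mul_div_sum_of_approxFactor
      (β := oversamplingConstant c * Real.log N * (ε ^ 2)⁻¹) hα (by positivity) h.nonneg happrox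
      hsum (hsize.trans_eq' (by ring)) i
    exact this.trans_eq' (by ring)

theorem theorem2_general :
    (∀ c : ℝ, 0 < c → ∃ Cs : ℝ, 0 < Cs ∧
      ∀ (n d N : ℕ) (A : Matrix (Fin n) (Fin d) ℝ) (w p : Fin n → ℝ) (ε : ℝ),
        IsLewisOverestimate A w → 0 < ε → ε ≤ 1 → 1 ≤ N →
        ∑ i, p i = (N : ℝ) →
        (∀ i, Cs * w i * Real.log (N : ℝ) * (ε ^ 2)⁻¹ ≤ p i) →
        ∀ (Ω : Type*) [MeasurableSpace Ω] (μ : Measure Ω) [IsProbabilityMeasure μ]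
          (idx : Fin N → Ω → Fin n),
          IsRowSampling μ p idx →
          1 - (N : ℝ) ^ (-c) ≤
            μ.real {ω | PreservesL1 ε (samplingMatrix p (fun k => idx k ω)) A}) ∧
    (∀ c : ℝ, 0 < c → ∀ α : ℝ, 1 ≤ α → ∃ K : ℝ, 0 < K ∧
      ∀ (n d N : ℕ) (A : Matrix (Fin n) (Fin d) ℝ) (w w' : Fin n → ℝ) (ε : ℝ),
        IsLewisOverestimate A w → (∀ i, ApproxFactor α (w i) (w' i)) →
        0 < ε → ε ≤ 1 → 1 ≤ ∑ i, w i → 2 ≤ (∑ i, w i) / ε →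
        K * (∑ i, w i) * Real.log ((∑ i, w i) / ε) * (ε ^ 2)⁻¹ ≤ (N : ℝ) →
        ∀ (Ω : Type*) [MeasurableSpace Ω] (μ : Measure Ω) [IsProbabilityMeasure μ]
          (idx : Fin N → Ω → Fin n),
          IsRowSampling μ (fun i => (N : ℝ) * w' i / ∑ j, w' j) idx →
          1 - (N : ℝ) ^ (-c) ≤
            μ.real {ω | PreservesL1 ε
              (samplingMatrix (fun i => (N : ℝ) * w' i / ∑ j, w' j) (fun k => idx k ω)) A}) := by
  refine ⟨fun c hc => ⟨_, oversamplingConstant_pos hc.le, ?_⟩, fun c hc α hα =>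
    ⟨32 * (oversamplingConstant c * α ^ 2) ^ 2 + 4 * (oversamplingConstant c * α ^ 2), ?_, ?_⟩⟩
  · intro n d N A w p ε h hε hε1 hN hpN hwp Ω _ μ _ idx hidx
    exact h.one_sub_rpow_le_measureReal_preservesL1 hc.le hε hε1 hN hpN hwp μ hidx
  · have := oversamplingConstant_pos hc.le
    positivity
  · intro n d N A w w' ε h happrox hε hε1 hw hwε hN Ω _ μ _ idx hidx
    exact h.one_sub_rpow_le_of_approxFactor hc.le (by positivity) happrox hε hε1 hw hwε hN μ hidx

theorem theorem2 :
    (∀ c : ℝ, 0 < c → ∃ Cs : ℝ, 0 < Cs ∧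
      ∀ (n d N : ℕ) (A : Matrix (Fin n) (Fin d) ℝ) (w p : Fin n → ℝ) (ε : ℝ),
        IsL1LewisWeights A w → 0 < ε → ε ≤ 1 → 1 ≤ N →
        ∑ i, p i = (N : ℝ) →
        (∀ i, Cs * w i * Real.log (N : ℝ) * (ε ^ 2)⁻¹ ≤ p i) →
        ∀ (Ω : Type*) [MeasurableSpace Ω] (μ : Measure Ω) [IsProbabilityMeasure μ]
          (idx : Fin N → Ω → Fin n),
          IsRowSampling μ p idx →
          1 - (N : ℝ) ^ (-c) ≤
            μ.real {ω | PreservesL1 ε (samplingMatrix p (fun k => idx k ω)) A}) ∧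
    (∀ c : ℝ, 0 < c → ∀ α : ℝ, 1 ≤ α → ∃ K : ℝ, 0 < K ∧
      ∀ (n d N : ℕ) (A : Matrix (Fin n) (Fin d) ℝ) (w w' : Fin n → ℝ) (ε : ℝ),
        IsL1LewisWeights A w → (∀ i, ApproxFactor α (w i) (w' i)) →
        0 < ε → ε ≤ 1 → 2 ≤ (d : ℝ) / ε →
        K * (d : ℝ) * Real.log ((d : ℝ) / ε) * (ε ^ 2)⁻¹ ≤ (N : ℝ) →
        ∀ (Ω : Type*) [MeasurableSpace Ω] (μ : Measure Ω) [IsProbabilityMeasure μ]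
          (idx : Fin N → Ω → Fin n),
          IsRowSampling μ (fun i => (N : ℝ) * w' i / ∑ j, w' j) idx →
          1 - (N : ℝ) ^ (-c) ≤
            μ.real {ω | PreservesL1 ε
              (samplingMatrix (fun i => (N : ℝ) * w' i / ∑ j, w' j) (fun k => idx k ω)) A}) := by
  obtain ⟨hoverestimate, happroximate⟩ := theorem2_general
  refine ⟨fun c hc => ?_, fun c hc α hα => ?_⟩
  · obtain ⟨Cs, hCs, hprob⟩ := hoverestimate c hc
    exact ⟨Cs, hCs, fun n d N A w p ε h => hprob n d N A w p ε h.isLewisOverestimate⟩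
  · obtain ⟨K, hK, hprob⟩ := happroximate c hc α hα
    refine ⟨K, hK, fun n d N A w w' ε h happrox hε hε1 hdε => ?_⟩
    have hd : d ≠ 0 := by rintro rfl; norm_num at hdε
    rw [← h.sum_eq] at hdε ⊢
    exact hprob n d N A w w' ε h.isLewisOverestimate happrox hε hε1 (h.one_le_sum hd) hdε
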